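/- Let $D\subsetneq\mathbb{C}$ be a simply connected domain, $w_0\in D$, and let $F,G$ be holomorphic on $D$ with $F\not\equiv 0$, $G$ not constant and $|G|<1$ on $D$. Put $\|G\|_\infty=\sup_{w\in D}|G(w)|$ and $h(w)=\int_{w_0}^w F\,dw$. For $\theta\in\mathbb{R}$, $\lambda>0$, $c\in\mathbb{R}$ let $$X_{\theta,\lambda,c}(w)=\operatorname{Re}\int_{w_0}^{w}\begin{pmatrix}1-c\lambda^2G^2\\ -i(1+c\lambda^2G^2)\\ 2\lambda G\end{pmatrix}\frac{e^{i\theta}}{\lambda}F\,dw,\qquad S_{\theta,\lambda,c}=X_{\theta,\lambda,c}(D)\subset\mathbb{R}^3 .$$ A set $S\subset\mathbb{R}^3$ is a graph over a domain $\Omega$ of the $xy$-plane (identified with $\mathbb{C}$) if $S=\{(x,y,\phi(x,y)) : (x,y)\in\Omega\}$ for some function $\phi\colon\Omega\to\mathbb{R}$, and it is a graph if this holds for some domain $\Omega$. A domain $\Omega\subset\mathbb{C}$ is close-to-convex if $\mathbb{C}\setminus\Omega$ is a union of closed half-lines that are pairwise disjoint except possibly for initial points (a common point of two of them is the initial point of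 at least one of them). 1. Suppose that $S_{\theta_0,\lambda_0,0}$ is a graph over a convex domain for some $\theta_0\in\mathbb{R}$, $\lambda_0>0$. Then $S_{\theta,\lambda,c}$ is a graph over a close-to-convex domain for all $\theta\in\mathbb{R}$, $\lambda>0$, $c\in\mathbb{R}$ with $|c\lambda^2|\le 1/\|G\|_\infty^2$. In particular, the minimal surfaces $S_{\theta,1,1}$ and the maximal surfaces $S_{\theta,1,-1}$ are graphs for every $\theta$. 2. There are $\theta_0\in\mathbb{R}$, $\lambda_0>0$ such that $S_{\theta_0,\lambda_0,0}$ is a graph over a convex domain and $X_{\theta_0,\lambda_0,0}$ is injective on $D$, if and only if $h$ is injective on $D$ and $h(D)$ is convex. 3. If $h$ is injective on $D$ and $h(D)$ is convex, then, for all $\theta\in\mathbb{R}$, $\lambda>0$, $c\in\mathbb{R}$ with $|c\lambda^2|\le 1/\|G\|_\infty^2$, the map $X_{\theta,\lambda,c}$ is moreover injective on $D$. -/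

import Mathlib

open Set

namespace Krust

/-! ### Primitives on a simply connected domain -/

/-- Holomorphic functions on simply connected open sets have primitives: the sheaf of local
primitives is a covering of `D` with discrete fibre `F ≃ ℂ`, and the identity lifts to it. -/
theorem exists_primitive_aux {F : Type} [TopologicalSpace F] [DiscreteTopology F] (e : F ≃ ℂ)
    {D : Set ℂ} (hDo : IsOpen D) (hDs : IsSimplyConnected D) {f : ℂ → ℂ}
    (hf : DifferentiableOn ℂ f D) : ∃ Φ : ℂ → ℂ, ∀ w ∈ D, HasDerivAt Φ (f w) w := by
  classical
  have := hDs.simplyConnectedSpace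
  have := hDo.locallyPathConnectedSpace
  have hloc : ∀ x : D, ∃ r : ℝ, 0 < r ∧ ∃ Φ : ℂ → ℂ, ∀ w ∈ Metric.ball (x : ℂ) r,
      HasDerivAt Φ (f w) w := by
    intro x
    obtain ⟨r, hr, hsub⟩ := Metric.isOpen_iff.1 hDo x x.2
    obtain ⟨Φ, hΦ⟩ := (hf.mono hsub).isExactOn_ball
    exact ⟨r, hr, Φ, hΦ⟩
  choose r hr Φ hΦ using hloc
  have hconst : ∀ i j : D, ∃ k : ℂ, ∀ z ∈ Metric.ball (i : ℂ) (r i) ∩ Metric.ball (j : ℂ) (r j),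
      Φ i z - Φ j z = k := by
    intro i j
    have hopen : IsOpen (Metric.ball (i : ℂ) (r i) ∩ Metric.ball (j : ℂ) (r j)) :=
      Metric.isOpen_ball.inter Metric.isOpen_ball
    have hpre : IsPreconnected (Metric.ball (i : ℂ) (r i) ∩ Metric.ball (j : ℂ) (r j)) :=
      ((convex_ball _ _).inter (convex_ball _ _)).isPreconnected
    have hd : ∀ z ∈ Metric.ball (i : ℂ) (r i) ∩ Metric.ball (j : ℂ) (r j),
        HasDerivAt (fun z => Φ i z - Φ j z) 0 z := by
      intro z hz
      have h := (hΦ i z hz.1).sub (hΦ j z hz.2)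
      rw [sub_self] at h
      exact h
    exact hopen.exists_is_const_of_deriv_eq_zero hpre
      (fun z hz => (hd z hz).differentiableAt.differentiableWithinAt) (fun z hz => (hd z hz).deriv)
  let Z : FiberBundleCore D D F :=
    { baseSet := fun i => {z : D | (z : ℂ) ∈ Metric.ball (i : ℂ) (r i)}
      isOpen_baseSet := fun i => Metric.isOpen_ball.preimage continuous_subtype_val
      indexAt := id
      mem_baseSet_at := fun x => Metric.mem_ball_self (hr x)
      coordChange := fun i j x v => e.symm (e v + (Φ i x - Φ j x))
      coordChange_self := fun i x _ v => by simp
      continuousOn_coordChange := by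
        intro i j
        obtain ⟨k, hk⟩ := hconst i j
        have : Continuous (fun p : D × F => e.symm (e p.2 + k)) :=
          (continuous_of_discreteTopology (f := fun v : F => e.symm (e v + k))).comp
            continuous_snd
        refine this.continuousOn.congr ?_
        rintro ⟨x, v⟩ ⟨hx, -⟩
        simp only
        rw [hk x hx]
      coordChange_comp := fun i j k x _ v => by
        simp only [Equiv.apply_symm_apply, EmbeddingLike.apply_eq_iff_eq]
        ring }
  have hcov : IsCoveringMap Z.proj := FiberBundle.isCoveringMap (F := F) (E := Z.Fiber)
  obtain ⟨x₀⟩ : Nonempty D := hDs.nonempty.to_subtype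
  obtain ⟨s, ⟨-, hs⟩, -⟩ := hcov.existsUnique_continuousMap_lifts (ContinuousMap.id D) x₀
    (⟨x₀, e.symm 0⟩ : Z.TotalSpace) rfl
  have hs' : ∀ x : D, (s x).proj = x := fun x => congrFun hs x
  let Ψ : D → ℂ := fun x => e (s x).snd + Φ x x
  refine ⟨fun w => if h : w ∈ D then Ψ ⟨w, h⟩ else 0, ?_⟩
  intro w hw
  have key : ∃ k : ℂ, ∀ᶠ x : D in nhds ⟨w, hw⟩, Ψ x = k + Φ ⟨w, hw⟩ x := by
    set a : D := ⟨w, hw⟩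
    have hmem : s a ∈ (Z.localTriv a).source := by
      rw [Z.mem_localTriv_source, hs']
      exact Metric.mem_ball_self (hr a)
    have hc : ContinuousAt (fun x : D => ((Z.localTriv a) (s x)).2) a :=
      continuousAt_snd.comp (((Z.localTriv a).continuousAt hmem).comp s.continuous.continuousAt)
    have hev : ∀ᶠ x : D in nhds a, ((Z.localTriv a) (s x)).2 = ((Z.localTriv a) (s a)).2 := by
      have := hc.eventually (p := fun v => v = ((Z.localTriv a) (s a)).2) (by simp [nhds_discrete])
      exact this
    refine ⟨e ((Z.localTriv a) (s a)).2, ?_⟩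
    filter_upwards [hev] with x hx
    rw [← hx, Z.localTriv_apply]
    have : (s x).proj = x := hs' x
    show e (s x).snd + Φ x x = e (e.symm (e (s x).snd + (Φ (s x).proj (s x).proj - Φ a (s x).proj)))
      + Φ a x
    rw [this]
    simp only [Equiv.apply_symm_apply]
    ring
  obtain ⟨k, hk⟩ := key
  have hk' : ∀ᶠ z : ℂ in nhds w, (if h : z ∈ D then Ψ ⟨z, h⟩ else 0) = k + Φ ⟨w, hw⟩ z := by
    have h1 : ∀ᶠ z : ℂ in nhds w, ∀ h : z ∈ D, Ψ ⟨z, h⟩ = k + Φ ⟨w, hw⟩ z := by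
      rw [nhds_subtype_eq_comap, Filter.eventually_comap] at hk
      filter_upwards [hk] with z hz h
      exact hz ⟨z, h⟩ rfl
    filter_upwards [h1, hDo.mem_nhds hw] with z hz hzD
    simp [hzD, hz]
  exact ((hΦ ⟨w, hw⟩ w (Metric.mem_ball_self (hr _))).const_add k).congr_of_eventuallyEq hk'

theorem exists_primitive {D : Set ℂ} (hDo : IsOpen D) (hDs : IsSimplyConnected D) {f : ℂ → ℂ}
    (hf : DifferentiableOn ℂ f D) : ∃ Φ : ℂ → ℂ, ∀ w ∈ D, HasDerivAt Φ (f w) w :=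
  @exists_primitive_aux ℂ ⊥ (@DiscreteTopology.mk ℂ ⊥ rfl) (Equiv.refl ℂ) D hDo hDs f hf

open Classical in
/-- `∫_{w₀}^w f dw`: the primitive of `f` on `D` that vanishes at `w₀`. For `f` holomorphic on a
simply connected domain `D` containing `w₀` it exists and is unique on `D` (see `primitive_spec`
and `primitive_eq`); the default value `0` is then never used. -/
noncomputable def primitive (D : Set ℂ) (w₀ : ℂ) (f : ℂ → ℂ) : ℂ → ℂ :=
  if h : ∃ Φ : ℂ → ℂ, Φ w₀ = 0 ∧ ∀ w ∈ D, HasDerivAt Φ (f w) w then Classical.choose h else 0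

theorem primitive_spec {D : Set ℂ} (hDo : IsOpen D) (hDs : IsSimplyConnected D) (w₀ : ℂ)
    {f : ℂ → ℂ} (hf : DifferentiableOn ℂ f D) :
    primitive D w₀ f w₀ = 0 ∧ ∀ w ∈ D, HasDerivAt (primitive D w₀ f) (f w) w := by
  have h : ∃ Φ : ℂ → ℂ, Φ w₀ = 0 ∧ ∀ w ∈ D, HasDerivAt Φ (f w) w := by
    obtain ⟨Φ, hΦ⟩ := exists_primitive hDo hDs hf
    exact ⟨fun w => Φ w - Φ w₀, sub_self _, fun w hw => (hΦ w hw).sub_const _⟩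
  unfold primitive
  rw [dif_pos h]
  exact Classical.choose_spec h

theorem primitive_eq {D : Set ℂ} (hDo : IsOpen D) (hDs : IsSimplyConnected D) {w₀ : ℂ}
    (hw₀ : w₀ ∈ D) {f Φ : ℂ → ℂ} (hΦ₀ : Φ w₀ = 0) (hΦ : ∀ w ∈ D, HasDerivAt Φ (f w) w) :
    ∀ w ∈ D, primitive D w₀ f w = Φ w := by
  have h : ∃ Φ : ℂ → ℂ, Φ w₀ = 0 ∧ ∀ w ∈ D, HasDerivAt Φ (f w) w := ⟨Φ, hΦ₀, hΦ⟩
  have hs : primitive D w₀ f w₀ = 0 ∧ ∀ w ∈ D, HasDerivAt (primitive D w₀ f) (f w) w := by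
    unfold primitive
    rw [dif_pos h]
    exact Classical.choose_spec h
  exact hDo.eqOn_of_deriv_eq hDs.isPathConnected.isConnected.isPreconnected
    (fun w hw => (hs.2 w hw).differentiableAt.differentiableWithinAt)
    (fun w hw => (hΦ w hw).differentiableAt.differentiableWithinAt)
    (fun w hw => by rw [(hs.2 w hw).deriv, (hΦ w hw).deriv]) hw₀ (by rw [hs.1, hΦ₀])

/-! ### The deformation family -/

/-- The map `X_{θ,λ,c} = Re ∫ (1 - cλ²G², -i(1 + cλ²G²), 2λG) (e^{iθ}/λ) F dw` on `D`, based at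
`w₀`, where a point `(x, y, t)` of three-space is written as `(x + iy, t) : ℂ × ℝ`. -/
noncomputable def surfaceMap (D : Set ℂ) (w₀ : ℂ) (F G : ℂ → ℂ) (θ lam c : ℝ) (w : ℂ) : ℂ × ℝ :=
  (⟨(primitive D w₀ (fun z => (1 - c * lam ^ 2 * G z ^ 2) *
        (Complex.exp (Complex.I * θ) / lam * F z)) w).re,
    (primitive D w₀ (fun z => -Complex.I * (1 + c * lam ^ 2 * G z ^ 2) *
        (Complex.exp (Complex.I * θ) / lam * F z)) w).re⟩,
   (primitive D w₀ (fun z => 2 * lam * G z *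
        (Complex.exp (Complex.I * θ) / lam * F z)) w).re)

/-- The surface `S_{θ,λ,c}`, the image of `X_{θ,λ,c}`. -/
noncomputable def surface (D : Set ℂ) (w₀ : ℂ) (F G : ℂ → ℂ) (θ lam c : ℝ) : Set (ℂ × ℝ) :=
  surfaceMap D w₀ F G θ lam c '' D

/-- `‖G‖_∞ = sup_{w ∈ D} |G(w)|`. -/
noncomputable def supNorm (D : Set ℂ) (G : ℂ → ℂ) : ℝ := sSup ((fun w => ‖G w‖) '' D)

/-! ### Graphs, convex and close-to-convex domains -/

/-- A domain of the plane: a nonempty connected open set. -/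
def IsDomainSet (Ω : Set ℂ) : Prop := IsOpen Ω ∧ IsConnected Ω

/-- `S` is the graph of a function on `Ω` (only the values of `φ` on `Ω` matter). -/
def IsGraphOver (S : Set (ℂ × ℝ)) (Ω : Set ℂ) : Prop :=
  ∃ φ : ℂ → ℝ, S = {p | p.1 ∈ Ω ∧ p.2 = φ p.1}

def IsConvexDomain (Ω : Set ℂ) : Prop := IsDomainSet Ω ∧ Convex ℝ Ω

/-- The closed half-line with initial point `p.1` and direction `p.2`. -/
def halfLine (p : ℂ × ℂ) : Set ℂ := {z | ∃ t : ℝ, 0 ≤ t ∧ z = p.1 + t * p.2}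

/-- A domain whose complement is a union of half-lines that are pairwise disjoint except possibly
for initial points. A half-line is recorded by its initial point and its unit direction vector. -/
def IsCloseToConvexDomain (Ω : Set ℂ) : Prop :=
  IsDomainSet Ω ∧ ∃ L : Set (ℂ × ℂ), (∀ p ∈ L, ‖p.2‖ = 1) ∧ Ωᶜ = ⋃ p ∈ L, halfLine p ∧
    ∀ p ∈ L, ∀ q ∈ L, p ≠ q → halfLine p ∩ halfLine q ⊆ {p.1, q.1}

/-- `S` is a graph (over some domain). -/
def IsGraph (S : Set (ℂ × ℝ)) : Prop := ∃ Ω, IsDomainSet Ω ∧ IsGraphOver S Ω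

/-- `S` is a graph over a convex domain. -/
def IsGraphOverConvex (S : Set (ℂ × ℝ)) : Prop := ∃ Ω, IsConvexDomain Ω ∧ IsGraphOver S Ω

/-- `S` is a graph over a close-to-convex domain. -/
def IsGraphOverCloseToConvex (S : Set (ℂ × ℝ)) : Prop :=
  ∃ Ω, IsCloseToConvexDomain Ω ∧ IsGraphOver S Ω

end Krust

/-! Write μ = e^{iθ}/λ and Ω = μ·h(D). For c = 0 the horizontal part of X is μh, so a graph over a
convex domain forces h(D) to be convex and Re ∫ 2λGμF to be constant on the fibres of h.
Differentiating along two local inverses of h shows that G itself is constant on those fibres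
(`eq_of_re_eq_of_eq`). Hence G = g(μh) with g holomorphic on Ω (`exists_holomorphic_factor`),
although h need not be assumed injective. In the coordinate z = μh the horizontal part of every X is
z + conj k(z) with k' = -cλ²g² (`exists_surfaceMap_eq`), and the maximum principle together with the
bound on c gives |k'| < 1. On the convex set Ω the map conj k strictly decreases distances, so z +
conj k is injective; it is also open.

For close-to-convexity, extend conj k to a nonexpansive P on the closure of Ω, let π be the
nearest-point projection onto that closure, and put T = id + P∘π on the whole plane. T translates
each outer normal ray of Ω at a by P(a), and the translated rays fill the range of T outside the
image of Ω. A point outside the range is separated from it (`exists_inner_le_of_forall_add_ne`),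
hence lies on an outer normal ray of the closed convex hull of the range. Disjointness within each
of these two families of rays comes from `IsNormalVec.norm_sub_sq_le`. -/

namespace Krust

open Filter Topology ComplexConjugate

/-! ### Normal cones and displacements of the identity by nonexpansive maps. -/

section ConvexAnalysis

variable {E : Type*} [NormedAddCommGroup E] [InnerProductSpace ℝ E]

/-- `n` lies in the normal cone of `K` at the point `a ∈ K`. -/
def IsNormalVec (K : Set E) (a n : E) : Prop := a ∈ K ∧ ∀ y ∈ K, inner ℝ n (y - a) ≤ 0

theorem exists_isNormalVec_sub [CompleteSpace E] {K : Set E} (hne : K.Nonempty)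
    (hcl : IsClosed K) (hK : Convex ℝ K) (x : E) : ∃ a, IsNormalVec K a (x - a) := by
  obtain ⟨a, ha, h⟩ := exists_norm_eq_iInf_of_complete_convex hne hcl.isComplete hK x
  exact ⟨a, ha, (norm_eq_iInf_iff_real_inner_le_zero hK ha).1 h⟩

theorem IsNormalVec.smul {K : Set E} {a n : E} (h : IsNormalVec K a n) {t : ℝ} (ht : 0 ≤ t) :
    IsNormalVec K a (t • n) :=
  ⟨h.1, fun y hy => by
    rw [real_inner_smul_left]
    exact mul_nonpos_of_nonneg_of_nonpos ht (h.2 y hy)⟩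

theorem IsNormalVec.inner_sub_nonneg {K : Set E} {a b m n : E} (ha : IsNormalVec K a m)
    (hb : IsNormalVec K b n) : 0 ≤ inner ℝ (a - b) (m - n) := by
  have h1 := ha.2 b hb.1
  have h2 := hb.2 a ha.1
  rw [← neg_sub a b, inner_neg_right] at h1
  rw [inner_sub_right, real_inner_comm, real_inner_comm n]
  linarith

/-- By monotonicity of the normal cone, the cross term in the expanded square is nonnegative. This
says that the projection and its residual are jointly nonexpansive, and its equality case separates
the half-lines later. -/
theorem IsNormalVec.norm_sub_sq_le {K : Set E} {a b m n : E} (ha : IsNormalVec K a m)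
    (hb : IsNormalVec K b n) :
    ‖a - b‖ ^ 2 + ‖m - n‖ ^ 2 ≤ ‖(a + m) - (b + n)‖ ^ 2 := by
  have h := ha.inner_sub_nonneg hb
  have : (a + m) - (b + n) = (a - b) + (m - n) := by abel
  rw [this, norm_add_sq_real]
  linarith

/-- From an interior point one could move slightly further along n inside K, but the normal
inequality excludes every a + s n with s > 0. -/
theorem IsNormalVec.notMem_interior {K : Set E} {a n : E} (h : IsNormalVec K a n) (hn : ‖n‖ = 1)
    {t : ℝ} (ht : 0 ≤ t) : a + t • n ∉ interior K := by
  intro hx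
  have hc : Tendsto (fun s : ℝ => a + s • n) (𝓝[>] t) (𝓝 (a + t • n)) :=
    (by fun_prop : Continuous fun s : ℝ => a + s • n).continuousAt.tendsto.mono_left
      nhdsWithin_le_nhds
  have hev := hc.eventually (mem_interior_iff_mem_nhds.1 hx)
  obtain ⟨s, hs, hst⟩ := (hev.and self_mem_nhdsWithin).exists
  have := h.2 _ hs
  rw [add_sub_cancel_left, real_inner_smul_right, real_inner_self_eq_norm_sq, hn] at this
  have : t < s := hst
  linarith

/-- A displacement of the identity by a nonexpansive map is a monotone operator whose range is
nearly convex: a value that is not taken can be separated from the range. -/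
theorem exists_inner_le_of_forall_add_ne [ProperSpace E] {q : E → E}
    (hq : ∀ x y, ‖q x - q y‖ ≤ ‖x - y‖) {w : E} (hw : ∀ x, x + q x ≠ w) :
    ∃ m : E, ‖m‖ = 1 ∧ ∀ y, inner ℝ m (y + q y - w) ≤ 0 := by
  have hqc : Continuous q :=
    (LipschitzWith.of_dist_le_mul (K := 1) fun x y => by
      simpa [dist_eq_norm] using hq x y).continuous
  -- The regularized equation is the fixed-point equation x = (1 + ε)⁻¹(w - q x), whose right side
  -- is a contraction.
  have hsolve : ∀ ε : ℝ, 0 < ε → ∃ x, x + q x + ε • x = w := by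
    intro ε hε
    have h1 : 0 < 1 + ε := by linarith
    let K : NNReal := ⟨(1 + ε)⁻¹, by positivity⟩
    have hK : ContractingWith K (fun x => (1 + ε)⁻¹ • (w - q x)) := by
      refine ⟨?_, LipschitzWith.of_dist_le_mul fun x y => ?_⟩
      · have : (1 + ε)⁻¹ < 1 := inv_lt_one_of_one_lt₀ (by linarith)
        exact_mod_cast this
      · rw [dist_eq_norm, dist_eq_norm, ← smul_sub, norm_smul, Real.norm_of_nonneg (by positivity)]
        refine mul_le_mul_of_nonneg_left ?_ (by positivity)
        rw [sub_sub_sub_cancel_left, norm_sub_rev]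
        exact hq x y
    refine ⟨hK.fixedPoint, ?_⟩
    have hfix : (1 + ε)⁻¹ • (w - q hK.fixedPoint) = hK.fixedPoint := hK.fixedPoint_isFixedPt
    set x := hK.fixedPoint
    have : w - q x = (1 + ε) • x := by
      rw [← hfix, smul_inv_smul₀ h1.ne', hfix]
    rw [add_smul, one_smul] at this
    rw [add_right_comm, ← this, sub_add_cancel]
  let ε : ℕ → ℝ := fun n => 1 / ((n : ℝ) + 1)
  have hε : ∀ n, 0 < ε n := fun n => Nat.one_div_pos_of_nat
  have hε1 : ∀ n, ε n ≤ 1 := fun n => by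
    have := Nat.one_div_le_one_div (α := ℝ) (Nat.zero_le n)
    simpa [ε] using this
  have hε0 : Tendsto ε atTop (𝓝 0) := tendsto_one_div_add_atTop_nhds_zero_nat
  choose x hx using fun n => hsolve (ε n) (hε n)
  -- Otherwise a convergent subsequence would yield a solution of x + q x = w in the limit ε → 0.
  have hlim : Tendsto (fun n => ‖x n‖) atTop atTop := by
    by_contra hcon
    simp only [tendsto_atTop, not_forall, not_eventually, not_le] at hcon
    obtain ⟨M, hM⟩ := hcon
    obtain ⟨a, -, φ, hφ, hφa⟩ := tendsto_subseq_of_frequently_bounded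
      (s := Metric.closedBall (0 : E) M) Metric.isBounded_closedBall
      (hM.mono fun n hn => by simpa using hn.le)
    have h1 : Tendsto (fun n => x (φ n) + q (x (φ n)) + ε (φ n) • x (φ n)) atTop
        (𝓝 (a + q a + (0 : ℝ) • a)) :=
      (hφa.add ((hqc.tendsto a).comp hφa)).add ((hε0.comp hφ.tendsto_atTop).smul hφa)
    simp only [hx, zero_smul, add_zero] at h1
    exact hw a (tendsto_nhds_unique h1 tendsto_const_nhds)
  have hpos : ∀ᶠ n in atTop, 0 < ‖x n‖ := hlim.eventually_gt_atTop 0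
  -- The separating vector is a limit direction of the diverging solutions. Monotonicity bounds ⟨x
  -- n, y + q y - w⟩ independently of n, so dividing by ‖x n‖ leaves a nonpositive limit.
  obtain ⟨m, hm, φ, hφ, hφm⟩ := (isCompact_sphere (0 : E) 1).tendsto_subseq'
    (x := fun n => ‖x n‖⁻¹ • x n) (hpos.mono fun n hn => by
      simp [norm_smul, hn.ne']).frequently
  refine ⟨m, by simpa using hm, fun y => ?_⟩
  have hbound : ∀ n, inner ℝ (x n) (y + q y - w) ≤ ‖y‖ ^ 2 + inner ℝ y (y + q y - w) := by
    intro n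
    have hmono : 0 ≤ inner ℝ (x n - y) ((x n + q (x n)) - (y + q y)) := by
      have h1 : (x n + q (x n)) - (y + q y) = (x n - y) + (q (x n) - q y) := by abel
      have h2 := abs_le.1 (abs_real_inner_le_norm (x n - y) (q (x n) - q y))
      have h3 := mul_le_mul_of_nonneg_left (hq (x n) y) (norm_nonneg (x n - y))
      rw [h1, inner_add_right, real_inner_self_eq_norm_sq]
      nlinarith [h2.1]
    have h4 : (x n + q (x n)) - (y + q y) = -(y + q y - w) - ε n • x n := by
      rw [← hx n]; abel
    rw [h4, inner_sub_right, inner_neg_right, real_inner_smul_right, inner_sub_left,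
      inner_sub_left, real_inner_self_eq_norm_sq] at hmono
    have h5 := abs_le.1 (abs_real_inner_le_norm y (x n))
    have h6 : inner ℝ y (x n) - ‖x n‖ ^ 2 ≤ ‖y‖ ^ 2 := by
      nlinarith [h5.2, sq_nonneg (‖x n‖ - ‖y‖ / 2), sq_nonneg ‖y‖]
    have h7 : ε n * (inner ℝ y (x n) - ‖x n‖ ^ 2) ≤ ‖y‖ ^ 2 := by
      calc ε n * (inner ℝ y (x n) - ‖x n‖ ^ 2) ≤ ε n * ‖y‖ ^ 2 :=
            mul_le_mul_of_nonneg_left h6 (hε n).le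
        _ ≤ 1 * ‖y‖ ^ 2 := mul_le_mul_of_nonneg_right (hε1 n) (sq_nonneg _)
        _ = ‖y‖ ^ 2 := one_mul _
    linarith
  set B := ‖y‖ ^ 2 + inner ℝ y (y + q y - w)
  have h1 : Tendsto (fun n => inner ℝ (‖x (φ n)‖⁻¹ • x (φ n)) (y + q y - w)) atTop
      (𝓝 (inner ℝ m (y + q y - w))) := hφm.inner tendsto_const_nhds
  have h2 : Tendsto (fun n => ‖x (φ n)‖⁻¹ * B) atTop (𝓝 (0 * B)) :=
    ((tendsto_inv_atTop_zero.comp hlim).comp hφ.tendsto_atTop).mul_const B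
  rw [zero_mul] at h2
  refine le_of_tendsto_of_tendsto' h1 h2 fun n => ?_
  rw [real_inner_smul_left]
  exact mul_le_mul_of_nonneg_left (hbound _) (by positivity)

end ConvexAnalysis

/-! ### Extension to the closure, and the half-lines filling the complement of the image. -/

theorem exists_nonexpansive_extension_closure {E : Type*} [NormedAddCommGroup E]
    [CompleteSpace E] {s : Set E} {p : E → E}
    (hp : ∀ a ∈ s, ∀ b ∈ s, ‖p a - p b‖ ≤ ‖a - b‖) :
    ∃ P : E → E, (∀ a ∈ s, P a = p a) ∧
      ∀ a ∈ closure s, ∀ b ∈ closure s, ‖P a - P b‖ ≤ ‖a - b‖ := by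
  have hL : LipschitzOnWith 1 p s := LipschitzOnWith.of_dist_le_mul fun x hx y hy => by
    simpa [dist_eq_norm] using hp x hx y hy
  have hext : ∀ a ∈ s, extendFrom s p a = p a := extendFrom_extends hL.continuousOn
  refine ⟨extendFrom s p, hext, ?_⟩
  have hc : ContinuousOn (extendFrom s p) (closure s) := by
    refine continuousOn_extendFrom subset_rfl fun x hx => ?_
    have : (𝓝[s] x).NeBot := mem_closure_iff_nhdsWithin_neBot.1 hx
    refine cauchy_map_iff_exists_tendsto.1 ?_
    exact (cauchy_nhds.mono nhdsWithin_le_nhds).map_of_le hL.uniformContinuousOn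
      (inf_le_right)
  have hL' : LipschitzOnWith 1 (extendFrom s p) s := LipschitzOnWith.of_dist_le_mul
    fun x hx y hy => by
      rw [hext x hx, hext y hy]
      simpa [dist_eq_norm] using hp x hx y hy
  intro a ha b hb
  simpa [dist_eq_norm] using (hL'.closure hc).dist_le_mul a ha b hb

theorem exists_unit_isNormalVec {Ω : Set ℂ} (hΩo : IsOpen Ω) (hΩc : Convex ℝ Ω)
    {x : ℂ} (hx : x ∈ closure Ω) (hxΩ : x ∉ Ω) :
    ∃ n : ℂ, ‖n‖ = 1 ∧ IsNormalVec (closure Ω) x n := by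
  obtain ⟨f, hf⟩ := geometric_hahn_banach_open_point hΩc hΩo hxΩ
  set v := (InnerProductSpace.toDual ℝ ℂ).symm f
  have hv : ∀ y, inner ℝ v y = f y := fun y => InnerProductSpace.toDual_symm_apply
  obtain ⟨a, ha⟩ : Ω.Nonempty := closure_nonempty_iff.1 ⟨x, hx⟩
  have hv0 : v ≠ 0 := by
    intro h0
    have := hf a ha
    rw [← hv, ← hv, h0, inner_zero_left, inner_zero_left] at this
    exact lt_irrefl _ this
  refine ⟨‖v‖⁻¹ • v, by simp [hv0], IsNormalVec.smul ⟨hx, ?_⟩ (by positivity)⟩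
  have hcl : IsClosed {y : ℂ | f y ≤ f x} := isClosed_le (by fun_prop) (by fun_prop)
  have hsub : closure Ω ⊆ {y : ℂ | f y ≤ f x} := closure_minimal (fun y hy => (hf y hy).le) hcl
  intro y hy
  rw [hv, map_sub]
  exact sub_nonpos.2 (hsub hy)

/-- The midpoint of x and y lies in Ω, so the inequality is strict on the half of the segment next
to x and weak on the other half. -/
theorem norm_sub_lt_of_mem_closure {Ω : Set ℂ} (hΩo : IsOpen Ω) (hΩc : Convex ℝ Ω) {P : ℂ → ℂ}
    (hlt : ∀ a ∈ Ω, ∀ b ∈ Ω, a ≠ b → ‖P a - P b‖ < ‖a - b‖)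
    (hle : ∀ a ∈ closure Ω, ∀ b ∈ closure Ω, ‖P a - P b‖ ≤ ‖a - b‖)
    {x y : ℂ} (hx : x ∈ Ω) (hy : y ∈ closure Ω) (hxy : x ≠ y) : ‖P x - P y‖ < ‖x - y‖ := by
  set m : ℂ := (1 / 2 : ℝ) • x + (1 / 2 : ℝ) • y with hm
  have hmΩ : m ∈ Ω := by
    have := hΩc.combo_interior_closure_mem_interior (x := x) (y := y)
      (by rwa [hΩo.interior_eq]) hy (a := 1 / 2) (b := 1 / 2) (by norm_num) (by norm_num)
      (by norm_num)
    rwa [hΩo.interior_eq] at this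
  have e1 : x - m = (1 / 2 : ℝ) • (x - y) := by rw [hm]; simp only [Complex.real_smul]; push_cast; ring
  have e2 : m - y = (1 / 2 : ℝ) • (x - y) := by rw [hm]; simp only [Complex.real_smul]; push_cast; ring
  have hxm : x ≠ m := by
    intro h
    rw [← sub_eq_zero, e1, smul_eq_zero, sub_eq_zero] at h
    exact h.elim (by norm_num) hxy
  have h1 := hlt x hx m hmΩ hxm
  have h2 := hle m (subset_closure hmΩ) y hy
  rw [e1, norm_smul, Real.norm_of_nonneg (by norm_num)] at h1
  rw [e2, norm_smul, Real.norm_of_nonneg (by norm_num)] at h2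
  have h3 := norm_sub_le_norm_sub_add_norm_sub (P x) (P m) (P y)
  linarith

/-- The complement of the image of a convex domain under a displacement of the identity by a
strictly contracting map is a union of half-lines: the images of the outer normals of the domain,
and the outer normals of the closed convex hull of the range of the extended map. -/
theorem exists_halfLines_compl_image {Ω : Set ℂ} (hΩo : IsOpen Ω) (hΩc : Convex ℝ Ω)
    (hne : Ω.Nonempty) {p : ℂ → ℂ} (hp : ∀ a ∈ Ω, ∀ b ∈ Ω, a ≠ b → ‖p a - p b‖ < ‖a - b‖)
    (hopen : IsOpen ((fun z => z + p z) '' Ω)) :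
    ∃ L : Set (ℂ × ℂ), (∀ l ∈ L, ‖l.2‖ = 1) ∧
      ((fun z => z + p z) '' Ω)ᶜ = ⋃ l ∈ L, halfLine l ∧
      ∀ l ∈ L, ∀ l' ∈ L, l ≠ l' → halfLine l ∩ halfLine l' ⊆ {l.1, l'.1} := by
  obtain ⟨P, hPp, hPle⟩ := exists_nonexpansive_extension_closure (s := Ω) (p := p) (by
    intro a ha b hb
    rcases eq_or_ne a b with rfl | h
    · simp
    · exact (hp a ha b hb h).le)
  have hPlt : ∀ a ∈ Ω, ∀ b ∈ Ω, a ≠ b → ‖P a - P b‖ < ‖a - b‖ := fun a ha b hb h => by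
    rw [hPp a ha, hPp b hb]; exact hp a ha b hb h
  have hcl : IsClosed (closure Ω) := isClosed_closure
  choose π hπ using exists_isNormalVec_sub hne.closure hcl hΩc.closure
  have hπeq : ∀ {a n : ℂ}, IsNormalVec (closure Ω) a n → π (a + n) = a := by
    intro a n h
    have h1 := (hπ (a + n)).norm_sub_sq_le h
    rw [add_sub_cancel, sub_self, norm_zero] at h1
    have h2 : ‖π (a + n) - a‖ = 0 := by
      nlinarith [norm_nonneg (π (a + n) - a), sq_nonneg ‖a + n - π (a + n) - n‖]
    exact sub_eq_zero.1 (norm_eq_zero.1 h2)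
  have hπΩ : ∀ {a : ℂ}, a ∈ closure Ω → π a = a := by
    intro a ha
    have : IsNormalVec (closure Ω) a 0 := ⟨ha, fun y _ => by simp⟩
    simpa using hπeq this
  set T : ℂ → ℂ := fun x => x + P (π x) with hT
  have hTS : (fun z => z + p z) '' Ω ⊆ range T := by
    rintro _ ⟨z, hz, rfl⟩
    refine ⟨z, ?_⟩
    simp only [hT]
    rw [hπΩ (subset_closure hz), hPp z hz]
  have hπle : ∀ x y, ‖P (π x) - P (π y)‖ ≤ ‖x - y‖ := by
    intro x y
    refine (hPle _ (hπ x).1 _ (hπ y).1).trans ?_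
    have := (hπ x).norm_sub_sq_le (hπ y)
    rw [add_sub_cancel, add_sub_cancel] at this
    exact (pow_le_pow_iff_left₀ (norm_nonneg _) (norm_nonneg _) two_ne_zero).1 (by nlinarith [sq_nonneg ‖x - π x - (y - π y)‖])
  set C : Set ℂ := closure (convexHull ℝ (range T)) with hC
  have hTC : range T ⊆ C := (subset_convexHull ℝ _).trans subset_closure
  have hCc : Convex ℝ C := (convex_convexHull ℝ _).closure
  have hCne : C.Nonempty := ⟨_, hTC ⟨0, rfl⟩⟩
  -- points of a normal half-line of `C` that lie in `C`
  have hCray : ∀ {c m : ℂ}, IsNormalVec C c m → ‖m‖ = 1 → ∀ {t : ℝ}, 0 ≤ t →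
      c + t • m ∈ C → t = 0 := by
    intro c m h hm t ht hmem
    have := h.2 _ hmem
    rw [add_sub_cancel_left, real_inner_smul_right, real_inner_self_eq_norm_sq, hm] at this
    linarith
  -- `L₁` consists of the T-images of the outer normal rays of Ω, `L₂` of the outer normal rays of
  -- C.
  let L₁ : Set (ℂ × ℂ) := {l | ∃ a, IsNormalVec (closure Ω) a l.2 ∧ ‖l.2‖ = 1 ∧ l.1 = a + P a}
  let L₂ : Set (ℂ × ℂ) := {l | IsNormalVec C l.1 l.2 ∧ ‖l.2‖ = 1}
  have hray₁ : ∀ {a n : ℂ}, IsNormalVec (closure Ω) a n → ∀ {t : ℝ}, 0 ≤ t →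
      T (a + t • n) = a + P a + t • n := by
    intro a n h t ht
    simp only [hT]
    rw [hπeq (h.smul ht)]
    ring
  -- If T x = T y with x ∈ Ω and y = a + t n on a normal ray, then ‖x - y‖ = ‖P x - P a‖ < ‖x - a‖ ≤
  -- ‖x - y‖.
  have hdisj₁ : ∀ l ∈ L₁, ∀ z ∈ halfLine l, z ∉ (fun z => z + p z) '' Ω := by
    rintro l ⟨a, ha, hn, hl⟩ z ⟨t, ht, rfl⟩ ⟨x, hx, hxz⟩
    have hTy := hray₁ ha ht
    rw [← hl, Complex.real_smul, ← hxz] at hTy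
    have hy : a + t • l.2 ∉ Ω := fun h =>
      ha.notMem_interior hn ht (interior_mono subset_closure (by rwa [hΩo.interior_eq]))
    set y := a + t • l.2
    have hπy : π y = a := hπeq (ha.smul ht)
    have h1 : y + P a = x + P x := by
      rw [hPp x hx, ← hπy]
      exact hTy
    have h2 : ‖x - y‖ = ‖P x - P a‖ := by
      rw [show x - y = P a - P x by linear_combination -h1, norm_sub_rev]
    have h3 : IsNormalVec (closure Ω) x 0 := ⟨subset_closure hx, fun y _ => by simp⟩
    have h4 := h3.norm_sub_sq_le (ha.smul ht)
    rw [add_zero] at h4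
    have hxa : x ≠ a := by
      rintro rfl
      have : x = y := by rw [← sub_eq_zero, ← norm_eq_zero, h2, sub_self, norm_zero]
      exact hy (this ▸ hx)
    have h5 := norm_sub_lt_of_mem_closure hΩo hΩc hPlt hPle hx ha.1 hxa
    have h6 : ‖x - (a + t • l.2)‖ = ‖P x - P a‖ := h2
    rw [h6] at h4
    nlinarith [norm_nonneg (P x - P a), sq_nonneg ‖0 - t • l.2‖]
  have hdisj₂ : ∀ l ∈ L₂, ∀ z ∈ halfLine l, z ∉ (fun z => z + p z) '' Ω := by
    rintro l ⟨hn, h1⟩ z ⟨t, ht, rfl⟩ hz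
    -- The image of Ω is open and contained in C, hence in the interior of C.
    refine hn.notMem_interior h1 ht ?_
    rw [Complex.real_smul]
    exact interior_mono (hTS.trans hTC) (by rwa [hopen.interior_eq])
  have hmeet : ∀ l ∈ L₁, ∀ l' ∈ L₂, halfLine l ∩ halfLine l' ⊆ {l'.1} := by
    rintro l ⟨a, ha, hn, hl⟩ l' ⟨hn', h1'⟩ z ⟨⟨t, ht, hz⟩, ⟨s, hs, hz'⟩⟩
    have hzC : z ∈ C := by
      rw [hz, hl, ← Complex.real_smul, ← hray₁ ha ht]
      exact hTC ⟨_, rfl⟩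
    rw [← Complex.real_smul] at hz'
    have := hCray hn' h1' hs (hz' ▸ hzC)
    rw [hz', this, zero_smul, add_zero]
    rfl
  have hsmul_inj : ∀ {m n : ℂ} {s t : ℝ}, ‖m‖ = 1 → ‖n‖ = 1 → 0 ≤ s → 0 ≤ t → s ≠ 0 →
      s • m = t • n → m = n := by
    intro m n s t hm hn hs ht hs0 h
    have h1 := congrArg norm h
    rw [norm_smul, norm_smul, hm, hn, Real.norm_of_nonneg hs, Real.norm_of_nonneg ht, mul_one,
      mul_one] at h1
    rw [← h1] at h
    exact smul_right_injective ℂ hs0 h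
  refine ⟨L₁ ∪ L₂, ?_, ?_, ?_⟩
  · rintro l (⟨_, -, h, -⟩ | ⟨-, h⟩) <;> exact h
  · ext w
    simp only [mem_iUnion, exists_prop]
    constructor
    · intro hw
      by_cases hwT : w ∈ range T
      · obtain ⟨x, rfl⟩ := hwT
        have hxΩ : x ∉ Ω := by
          intro hx
          refine hw ⟨x, hx, ?_⟩
          simp only [hT]
          rw [hπΩ (subset_closure hx), hPp x hx]
        -- At a boundary point the residual x - π x vanishes and gives no direction; a supporting
        -- line supplies one instead.
        by_cases hx : x ∈ closure Ω
        · obtain ⟨n, hn, h⟩ := exists_unit_isNormalVec hΩo hΩc hx hxΩ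
          refine ⟨(x + P x, n), Or.inl ⟨x, h, hn, rfl⟩, 0, le_rfl, ?_⟩
          simp [hT, hπΩ hx]
        · have hne' : x - π x ≠ 0 := fun h => hx (by
            rw [sub_eq_zero.1 h]; exact (hπ x).1)
          have hpos : ‖x - π x‖ ≠ 0 := norm_ne_zero_iff.2 hne'
          refine ⟨(π x + P (π x), ‖x - π x‖⁻¹ • (x - π x)),
            Or.inl ⟨π x, (hπ x).smul (by positivity), by simp [hpos], rfl⟩,
            ‖x - π x‖, norm_nonneg _, ?_⟩
          simp only [hT]
          rw [← Complex.real_smul, smul_inv_smul₀ hpos]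
          ring
      · obtain ⟨m, hm, hle⟩ := exists_inner_le_of_forall_add_ne hπle
          (w := w) fun x hx => hwT ⟨x, hx⟩
        have hCle : ∀ y ∈ C, inner ℝ m (y - w) ≤ 0 := by
          have hcl : IsClosed {y : ℂ | inner ℝ m (y - w) ≤ 0} :=
            isClosed_le (by fun_prop) continuous_const
          have hcv : Convex ℝ {y : ℂ | inner ℝ m (y - w) ≤ 0} := by
            have : {y : ℂ | inner ℝ m (y - w) ≤ 0} = {y : ℂ | inner ℝ m y ≤ inner ℝ m w} := by
              ext y; simp [inner_sub_right]
            rw [this]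
            exact convex_halfSpace_le (innerSL ℝ m).toLinearMap.isLinear _
          exact closure_minimal (convexHull_min (by rintro _ ⟨y, rfl⟩; exact hle y) hcv) hcl
        -- If w lies in C, it is itself the initial point of a ray with normal m; otherwise its
        -- nearest point in C is the initial point.
        by_cases hwC : w ∈ C
        · exact ⟨(w, m), Or.inr ⟨⟨hwC, hCle⟩, hm⟩, 0, le_rfl, by simp⟩
        · obtain ⟨c, hc⟩ := exists_isNormalVec_sub hCne isClosed_closure hCc w
          have hne' : w - c ≠ 0 := fun h => hwC (by rw [sub_eq_zero.1 h]; exact hc.1)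
          have hpos : ‖w - c‖ ≠ 0 := norm_ne_zero_iff.2 hne'
          refine ⟨(c, ‖w - c‖⁻¹ • (w - c)),
            Or.inr ⟨hc.smul (by positivity), by simp [hpos]⟩,
            ‖w - c‖, norm_nonneg _, ?_⟩
          dsimp only
          rw [← Complex.real_smul, smul_inv_smul₀ hpos]
          ring
    · rintro ⟨l, hl | hl, hw⟩
      · exact hdisj₁ l hl w hw
      · exact hdisj₂ l hl w hw
  · rintro l (hl | hl) l' (hl' | hl') hll'
    · obtain ⟨a, ha, hn, hla⟩ := hl
      obtain ⟨b, hb, hn', hlb⟩ := hl'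
      rintro z ⟨⟨t, ht, hz⟩, ⟨s, hs, hz'⟩⟩
      by_contra hzn
      simp only [mem_insert_iff, mem_singleton_iff, not_or] at hzn
      have ht0 : t ≠ 0 := fun h => hzn.1 (by rw [hz, h]; simp)
      have hxy : a + P a + t • l.2 = b + P b + s • l'.2 := by
        rw [← hla, ← hlb, Complex.real_smul, Complex.real_smul, ← hz, ← hz']
      -- The preimages under T differ by P b - P a, of norm at most ‖a - b‖. This leaves no room for
      -- a difference of the normal parts, so the two rays coincide.
      have h1 := (ha.smul ht).norm_sub_sq_le (hb.smul hs)
      have h2 : (a + t • l.2) - (b + s • l'.2) = P b - P a := by linear_combination hxy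
      have h3 := hPle b hb.1 a ha.1
      rw [norm_sub_rev b a] at h3
      rw [h2] at h1
      have h4 : ‖t • l.2 - s • l'.2‖ = 0 := by
        have := pow_le_pow_left₀ (norm_nonneg _) h3 2
        exact pow_eq_zero_iff two_ne_zero |>.1 (le_antisymm (by linarith) (sq_nonneg _))
      have h5 := sub_eq_zero.1 (norm_eq_zero.1 h4)
      rw [h5] at hxy
      exact hll' (Prod.ext (by rw [hla, hlb]; exact add_right_cancel hxy)
        (hsmul_inj hn hn' ht hs ht0 h5))
    · exact (hmeet l hl l' hl').trans (by simp)
    · rw [inter_comm]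
      exact (hmeet l' hl' l hl).trans (by simp)
    · obtain ⟨hc, hn⟩ := hl
      obtain ⟨hd, hn'⟩ := hl'
      rintro z ⟨⟨t, ht, hz⟩, ⟨s, hs, hz'⟩⟩
      by_contra hzn
      simp only [mem_insert_iff, mem_singleton_iff, not_or] at hzn
      have ht0 : t ≠ 0 := fun h => hzn.1 (by rw [hz, h]; simp)
      have h1 := (hc.smul ht).norm_sub_sq_le (hd.smul hs)
      rw [Complex.real_smul, Complex.real_smul, ← hz, ← hz', sub_self, norm_zero] at h1
      have h2 : ‖l.1 - l'.1‖ = 0 := by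
        nlinarith [sq_nonneg ‖l.1 - l'.1‖, sq_nonneg ‖(t : ℂ) * l.2 - s * l'.2‖]
      have h3 := sub_eq_zero.1 (norm_eq_zero.1 h2)
      have h4 : t • l.2 = s • l'.2 := by
        rw [Complex.real_smul, Complex.real_smul]
        linear_combination hz' - hz - h3
      exact hll' (Prod.ext h3 (hsmul_inj hn hn' ht hs ht0 h4))

/-! ### Harmonic maps z + conj k on a convex domain. -/

theorem norm_sub_lt_of_norm_deriv_lt_one {Ω : Set ℂ} (hΩo : IsOpen Ω) (hΩc : Convex ℝ Ω)
    {k k' : ℂ → ℂ} (hk : ∀ z ∈ Ω, HasDerivAt k (k' z) z) (hk' : ∀ z ∈ Ω, ‖k' z‖ < 1)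
    {a b : ℂ} (ha : a ∈ Ω) (hb : b ∈ Ω) (hab : a ≠ b) : ‖k a - k b‖ < ‖a - b‖ := by
  have hd : DifferentiableOn ℂ k Ω := fun z hz => (hk z hz).differentiableAt.differentiableWithinAt
  have hseg : segment ℝ b a ⊆ Ω := hΩc.segment_subset hb ha
  have hcont : ContinuousOn (fun z => ‖deriv k z‖) (segment ℝ b a) :=
    ((hd.deriv hΩo).continuousOn.mono hseg).norm
  have hcomp : IsCompact (segment ℝ b a) := by
    rw [segment_eq_image_lineMap]
    exact isCompact_Icc.image AffineMap.lineMap_continuous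
  -- No uniform bound below 1 is available on Ω, but |k'| attains its maximum on the compact
  -- segment.
  obtain ⟨c, hc, hmax⟩ := hcomp.exists_isMaxOn ⟨a, right_mem_segment ℝ b a⟩ hcont
  have hlt : ‖deriv k c‖ < 1 := by rw [(hk c (hseg hc)).deriv]; exact hk' c (hseg hc)
  have h := (convex_segment b a).norm_image_sub_le_of_norm_deriv_le
    (fun z hz => (hk z (hseg hz)).differentiableAt) (fun z hz => hmax hz)
    (left_mem_segment ℝ b a) (right_mem_segment ℝ b a)
  have hpos : 0 < ‖a - b‖ := norm_pos_iff.2 (sub_ne_zero.2 hab)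
  exact h.trans_lt (by nlinarith)

theorem isOpen_image_add_conj {Ω : Set ℂ} (hΩo : IsOpen Ω)
    {k k' : ℂ → ℂ} (hk : ∀ z ∈ Ω, HasDerivAt k (k' z) z) (hk' : ∀ z ∈ Ω, ‖k' z‖ < 1) :
    IsOpen ((fun z => z + conj (k z)) '' Ω) := by
  rw [isOpen_iff_mem_nhds]
  rintro _ ⟨z, hz, rfl⟩
  have hd : DifferentiableOn ℂ k Ω := fun z hz => (hk z hz).differentiableAt.differentiableWithinAt
  have h1 : HasStrictDerivAt k (k' z) z := by
    rw [← (hk z hz).deriv]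
    exact (hd.analyticAt (hΩo.mem_nhds hz)).hasStrictDerivAt
  have h2 : HasStrictFDerivAt k ((ContinuousLinearMap.toSpanSingleton ℂ (k' z)).restrictScalars ℝ) z :=
    h1.hasStrictFDerivAt.restrictScalars ℝ
  have h3 := (hasStrictFDerivAt_id (𝕜 := ℝ) z).add
    ((Complex.conjCLE : ℂ →L[ℝ] ℂ).hasStrictFDerivAt.comp z h2)
  -- The real differential v ↦ v + conj (k' v) has trivial kernel because |k'| < 1, so it is
  -- surjective by dimension.
  have h4 := h3.map_nhds_eq_of_surj (by
    rw [LinearMap.range_eq_top]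
    refine LinearMap.injective_iff_surjective.1 ?_
    rw [injective_iff_map_eq_zero]
    intro v hv
    have hv' : v + conj (v * k' z) = 0 := by simpa using hv
    by_contra hv0
    have h5 : ‖v‖ = ‖v‖ * ‖k' z‖ := by
      rw [← norm_mul, ← RCLike.norm_conj (v * k' z), ← norm_neg v, neg_eq_of_add_eq_zero_right hv']
    have h6 := hk' z hz
    have h7 := norm_pos_iff.2 hv0
    nlinarith)
  have h5 := image_mem_map (m := fun z => z + conj (k z)) (hΩo.mem_nhds hz)
  exact (show map (fun z => z + conj (k z)) (𝓝 z) = 𝓝 (z + conj (k z)) from h4) ▸ h5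

/-- Harmonic maps `z + conj k` of a convex domain with `|k'| < 1` are injective. -/
theorem injOn_add_conj {Ω : Set ℂ} (hΩo : IsOpen Ω) (hΩc : Convex ℝ Ω)
    {k k' : ℂ → ℂ} (hk : ∀ z ∈ Ω, HasDerivAt k (k' z) z) (hk' : ∀ z ∈ Ω, ‖k' z‖ < 1) :
    InjOn (fun z => z + conj (k z)) Ω := by
  intro a ha b hb hab
  by_contra hne
  have h := norm_sub_lt_of_norm_deriv_lt_one hΩo hΩc hk hk' ha hb hne
  have h2 : a - b = -conj (k a - k b) := by
    rw [map_sub]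
    have hab' : a + conj (k a) = b + conj (k b) := hab
    linear_combination hab'
  rw [h2, norm_neg, RCLike.norm_conj] at h
  exact lt_irrefl _ h

/-- Harmonic maps `z + conj k` of a convex domain with `|k'| < 1` have a close-to-convex image. -/
theorem isCloseToConvexDomain_image_add_conj {Ω : Set ℂ} (hΩo : IsOpen Ω) (hΩc : Convex ℝ Ω)
    (hne : Ω.Nonempty) {k k' : ℂ → ℂ} (hk : ∀ z ∈ Ω, HasDerivAt k (k' z) z)
    (hk' : ∀ z ∈ Ω, ‖k' z‖ < 1) : IsCloseToConvexDomain ((fun z => z + conj (k z)) '' Ω) := by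
  have hopen := isOpen_image_add_conj hΩo hk hk'
  have hcont : ContinuousOn (fun z => z + conj (k z)) Ω := fun z hz =>
    (continuousAt_id.add (Complex.continuous_conj.continuousAt.comp
      (hk z hz).continuousAt)).continuousWithinAt
  refine ⟨⟨hopen, (hΩc.isConnected hne).image _ hcont⟩,
    exists_halfLines_compl_image hΩo hΩc hne (p := fun z => conj (k z)) ?_ hopen⟩
  intro a ha b hb hab
  rw [← map_sub, RCLike.norm_conj]
  exact norm_sub_lt_of_norm_deriv_lt_one hΩo hΩc hk hk' ha hb hab

/-! ### Factoring G through h, critical points included. -/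

section Factorization

variable {D : Set ℂ} {h F G : ℂ → ℂ}

theorem eventually_ne_zero_of_isPreconnected (hDo : IsOpen D) (hDc : IsPreconnected D)
    (hF : DifferentiableOn ℂ F D) (hF0 : ∃ w ∈ D, F w ≠ 0) {w : ℂ} (hw : w ∈ D) :
    ∀ᶠ z in 𝓝[≠] w, F z ≠ 0 := by
  by_contra hcon
  have hfr : ∃ᶠ z in 𝓝[≠] w, F z = 0 := (not_eventually.1 hcon).mono fun z => not_not.1
  obtain ⟨z, hz, hFz⟩ := hF0
  exact hFz ((hF.analyticOnNhd hDo).eqOn_zero_of_preconnected_of_frequently_eq_zero hDc hw hfr hz)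

theorem nhds_le_map_nhds_of_eventually_deriv_ne_zero (hDo : IsOpen D)
    (hh : ∀ w ∈ D, HasDerivAt h (F w) w) {w : ℂ} (hw : w ∈ D) (hFw : ∀ᶠ z in 𝓝[≠] w, F z ≠ 0) :
    𝓝 (h w) ≤ map h (𝓝 w) := by
  have hd : DifferentiableOn ℂ h D := fun z hz => (hh z hz).differentiableAt.differentiableWithinAt
  refine ((hd.analyticAt (hDo.mem_nhds hw)).eventually_constant_or_nhds_le_map_nhds).resolve_left
    fun hc => ?_
  have h1 : ∀ᶠ z in 𝓝[≠] w, F z = 0 := by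
    filter_upwards [nhdsWithin_le_nhds hc.eventually_nhds,
      nhdsWithin_le_nhds (hDo.mem_nhds hw)] with z hz hzD
    rw [← (hh z hzD).deriv]
    have : h =ᶠ[𝓝 z] fun _ => h w := hz
    rw [this.deriv_eq, deriv_const]
  obtain ⟨z, h2, h3⟩ := (h1.and hFw).exists
  exact h3 h2

theorem exists_local_inverse (hDo : IsOpen D) (hh : ∀ w ∈ D, HasDerivAt h (F w) w) {w : ℂ}
    (hw : w ∈ D) (hFw : F w ≠ 0) :
    ∃ s : ℂ → ℂ, HasDerivAt s (F w)⁻¹ (h w) ∧ s (h w) = w ∧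
      ∀ᶠ z in 𝓝 (h w), s z ∈ D ∧ h (s z) = z := by
  have hd : DifferentiableOn ℂ h D := fun z hz => (hh z hz).differentiableAt.differentiableWithinAt
  have h1 : HasStrictDerivAt h (F w) w := by
    rw [← (hh w hw).deriv]
    exact (hd.analyticAt (hDo.mem_nhds hw)).hasStrictDerivAt
  have h2 := (h1.to_localInverse hFw).hasDerivAt
  have h3 : h1.localInverse h (F w) w hFw (h w) = w :=
    HasStrictFDerivAt.localInverse_apply_image (h1.hasStrictFDerivAt_equiv hFw)
  refine ⟨h1.localInverse h (F w) w hFw, h2, h3, ?_⟩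
  have h4 : ∀ᶠ z in 𝓝 (h w), h1.localInverse h (F w) w hFw z ∈ D :=
    h2.continuousAt.eventually_mem (by rw [h3]; exact hDo.mem_nhds hw)
  exact h4.and (HasStrictFDerivAt.eventually_right_inverse (h1.hasStrictFDerivAt_equiv hFw))

/-- A holomorphic function that is constant on the fibres of a nonconstant holomorphic function
factors through it holomorphically. -/
theorem exists_holomorphic_factor (hDo : IsOpen D) (hDc : IsPreconnected D)
    (hF : DifferentiableOn ℂ F D) (hF0 : ∃ w ∈ D, F w ≠ 0)
    (hh : ∀ w ∈ D, HasDerivAt h (F w) w) (hG : DifferentiableOn ℂ G D)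
    (hfib : ∀ a ∈ D, ∀ b ∈ D, h a = h b → G a = G b) :
    ∃ g : ℂ → ℂ, DifferentiableOn ℂ g (h '' D) ∧ ∀ w ∈ D, G w = g (h w) := by
  classical
  let g : ℂ → ℂ := fun z => if hz : ∃ w ∈ D, h w = z then G hz.choose else 0
  have hg : ∀ w ∈ D, G w = g (h w) := by
    intro w hw
    have hz : ∃ w' ∈ D, h w' = h w := ⟨w, hw, rfl⟩
    simp only [g]
    rw [dif_pos hz]
    exact hfib _ hw _ hz.choose_spec.1 hz.choose_spec.2.symm
  have hreg : ∀ w ∈ D, F w ≠ 0 → DifferentiableAt ℂ g (h w) := by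
    intro w hw hFw
    obtain ⟨s, hs, hsw, hev⟩ := exists_local_inverse hDo hh hw hFw
    have h1 : DifferentiableAt ℂ (fun z => G (s z)) (h w) := by
      refine DifferentiableAt.comp (h w) ?_ hs.differentiableAt
      rw [hsw]
      exact hG.differentiableAt (hDo.mem_nhds hw)
    refine h1.congr_of_eventuallyEq ?_
    filter_upwards [hev] with z hz
    rw [hg _ hz.1, hz.2]
  refine ⟨g, ?_, hg⟩
  rintro _ ⟨w, hw, rfl⟩
  refine DifferentiableAt.differentiableWithinAt ?_
  have hFw := eventually_ne_zero_of_isPreconnected hDo hDc hF hF0 hw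
  have hmap := nhds_le_map_nhds_of_eventually_deriv_ne_zero hDo hh hw hFw
  have hcont : ContinuousAt g (h w) := by
    have h1 : Tendsto g (map h (𝓝 w)) (𝓝 (g (h w))) := by
      rw [tendsto_map'_iff, ← hg w hw]
      refine Tendsto.congr' ?_ (hG.differentiableAt (hDo.mem_nhds hw)).continuousAt
      filter_upwards [hDo.mem_nhds hw] with z hz using hg z hz
    exact h1.mono_left hmap
  -- Removable singularity: zeros of F are isolated and h is open, so every value near h(w) other
  -- than h(w) is taken at a point where F ≠ 0.
  refine (Complex.analyticAt_of_differentiable_on_punctured_nhds_of_continuousAt ?_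
    hcont).differentiableAt
  have h1 : ∀ᶠ z in 𝓝 w, z ∈ D ∧ (z ≠ w → F z ≠ 0) :=
    (hDo.eventually_mem hw).and (eventually_nhdsWithin_iff.1 hFw)
  have h2 := hmap (image_mem_map h1)
  filter_upwards [nhdsWithin_le_nhds h2, self_mem_nhdsWithin] with z hz hzne
  obtain ⟨w', ⟨hw'D, hw'F⟩, rfl⟩ := hz
  exact hreg w' hw'D (hw'F fun h0 => hzne (by rw [h0]; rfl))

/-- If the real part of a primitive of `G F` is constant on the fibres of the primitive `h` of
`F`, then so is `G`. -/
theorem eq_of_re_eq_of_eq (hDo : IsOpen D) (hDc : IsPreconnected D)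
    (hF : DifferentiableOn ℂ F D) (hF0 : ∃ w ∈ D, F w ≠ 0)
    (hh : ∀ w ∈ D, HasDerivAt h (F w) w) (hG : DifferentiableOn ℂ G D)
    {U : ℂ → ℂ} (hU : ∀ w ∈ D, HasDerivAt U (G w * F w) w)
    (hfib : ∀ a ∈ D, ∀ b ∈ D, h a = h b → (U a).re = (U b).re) :
    ∀ a ∈ D, ∀ b ∈ D, h a = h b → G a = G b := by
  have hreg : ∀ a ∈ D, ∀ b ∈ D, F a ≠ 0 → F b ≠ 0 → h a = h b → G a = G b := by
    intro a ha b hb hFa hFb hab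
    obtain ⟨s, hs, hsa, hevs⟩ := exists_local_inverse hDo hh ha hFa
    obtain ⟨t, ht, htb, hevt⟩ := exists_local_inverse hDo hh hb hFb
    rw [← hab] at ht htb hevt
    have h1 : HasDerivAt (fun z => U (s z)) (G a) (h a) := by
      have := HasDerivAt.comp (h a) (h₂ := U) (by rw [hsa]; exact hU a ha) hs
      rwa [mul_assoc, mul_inv_cancel₀ hFa, mul_one] at this
    have h2 : HasDerivAt (fun z => U (t z)) (G b) (h a) := by
      have := HasDerivAt.comp (h a) (h₂ := U) (by rw [htb]; exact hU b hb) ht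
      rwa [mul_assoc, mul_inv_cancel₀ hFb, mul_one] at this
    have h3 : HasDerivAt (fun z => U (s z) - U (t z)) (G a - G b) (h a) := h1.sub h2
    -- Re (U∘s - U∘t) vanishes near h(a), and the complex derivative of U∘s - U∘t there is G a - G
    -- b. The directions 1 and i then determine that number.
    have hline : ∀ v : ℂ, ((G a - G b) * v).re = 0 := by
      intro v
      have h4 : HasDerivAt (fun r : ℝ => h a + r * v) v 0 := by
        simpa using (((hasDerivAt_id (0 : ℝ)).ofReal_comp).mul_const v).const_add (h a)
      have h5 : HasDerivAt (fun r : ℝ => U (s (h a + r * v)) - U (t (h a + r * v)))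
          ((G a - G b) * v) 0 :=
        HasDerivAt.comp (0 : ℝ) (h₂ := fun z => U (s z) - U (t z))
          (by rwa [Complex.ofReal_zero, zero_mul, add_zero]) h4
      have h6 : HasDerivAt (fun r : ℝ => (U (s (h a + r * v)) - U (t (h a + r * v))).re)
          ((G a - G b) * v).re 0 :=
        Complex.reCLM.hasFDerivAt.comp_hasDerivAt (0 : ℝ) h5
      have h7 : Tendsto (fun r : ℝ => h a + r * v) (𝓝 0) (𝓝 (h a)) := by
        simpa using h4.continuousAt.tendsto
      have h8 : (fun r : ℝ => (U (s (h a + r * v)) - U (t (h a + r * v))).re) =ᶠ[𝓝 0]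
          fun _ => 0 := by
        filter_upwards [h7.eventually hevs, h7.eventually hevt] with r hr1 hr2
        rw [Complex.sub_re, sub_eq_zero]
        exact hfib _ hr1.1 _ hr2.1 (by rw [hr1.2, hr2.2])
      exact h6.unique ((hasDerivAt_const (0 : ℝ) (0 : ℝ)).congr_of_eventuallyEq h8)
    have h9 := hline 1
    have h10 := hline Complex.I
    simp at h9 h10
    exact sub_eq_zero.1 (Complex.ext (by simpa using h9) (by simp; linarith))
  intro a ha b hb hab
  by_contra hne
  have hcont : ∀ w ∈ D, ContinuousAt G w := fun w hw =>
    (hG.differentiableAt (hDo.mem_nhds hw)).continuousAt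
  obtain ⟨V, W, hV, hW, haV, hbW, hVW⟩ := t2_separation hne
  have hFa := eventually_ne_zero_of_isPreconnected hDo hDc hF hF0 ha
  have hFb := eventually_ne_zero_of_isPreconnected hDo hDc hF hF0 hb
  have h1 : ∀ᶠ z in 𝓝 a, (z ∈ D ∧ (z ≠ a → F z ≠ 0)) ∧ G z ∈ V :=
    ((hDo.eventually_mem ha).and (eventually_nhdsWithin_iff.1 hFa)).and
      ((hcont a ha).eventually_mem (hV.mem_nhds haV))
  have h2 : ∀ᶠ z in 𝓝 b, (z ∈ D ∧ (z ≠ b → F z ≠ 0)) ∧ G z ∈ W :=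
    ((hDo.eventually_mem hb).and (eventually_nhdsWithin_iff.1 hFb)).and
      ((hcont b hb).eventually_mem (hW.mem_nhds hbW))
  -- If G a ≠ G b, openness of h gives noncritical x near a and y near b with h x = h y and
  -- separated values of G, contradicting the regular case.
  have h3 := nhds_le_map_nhds_of_eventually_deriv_ne_zero hDo hh ha hFa (image_mem_map h1)
  have h4 := nhds_le_map_nhds_of_eventually_deriv_ne_zero hDo hh hb hFb (image_mem_map h2)
  rw [← hab] at h4
  have h5 : ∀ᶠ z in 𝓝[≠] (h a), z ∈ h '' {z | (z ∈ D ∧ (z ≠ a → F z ≠ 0)) ∧ G z ∈ V} ∧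
      z ∈ h '' {z | (z ∈ D ∧ (z ≠ b → F z ≠ 0)) ∧ G z ∈ W} ∧ z ≠ h a := by
    filter_upwards [nhdsWithin_le_nhds h3, nhdsWithin_le_nhds h4, self_mem_nhdsWithin]
      with z hz1 hz2 hz3 using ⟨hz1, hz2, hz3⟩
  obtain ⟨_, ⟨x, ⟨⟨hxD, hxF⟩, hxV⟩, rfl⟩, ⟨y, ⟨⟨hyD, hyF⟩, hyW⟩, hyx⟩, hxa⟩ := h5.exists
  have hxy := hreg x hxD y hyD (hxF fun h0 => hxa (by rw [h0]))
    (hyF fun h0 => hxa (by rw [← hyx, h0, hab])) hyx.symm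
  exact disjoint_left.1 hVW hxV (hxy ▸ hyW)

end Factorization

/-! ### The surfaces in the coordinate z = μh. -/

section Surface

variable {D : Set ℂ} {w₀ : ℂ} {F G : ℂ → ℂ}

theorem norm_lt_supNorm (hDo : IsOpen D) (hDc : IsPreconnected D) (hG : DifferentiableOn ℂ G D)
    (hGnc : ¬ ∃ a : ℂ, ∀ w ∈ D, G w = a) (hG1 : ∀ w ∈ D, ‖G w‖ < 1) {w : ℂ} (hw : w ∈ D) :
    ‖G w‖ < supNorm D G := by
  have hbdd : BddAbove ((fun w => ‖G w‖) '' D) :=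
    ⟨1, by rintro _ ⟨z, hz, rfl⟩; exact (hG1 z hz).le⟩
  have hle : ∀ z ∈ D, ‖G z‖ ≤ supNorm D G := fun z hz => le_csSup hbdd ⟨z, hz, rfl⟩
  refine lt_of_le_of_ne (hle w hw) fun heq => hGnc ⟨G w, ?_⟩
  refine Complex.eqOn_of_isPreconnected_of_isMaxOn_norm hDc hDo hG hw fun z hz => ?_
  show ‖G z‖ ≤ ‖G w‖
  rw [heq]
  exact hle z hz

theorem abs_mul_norm_sq_lt_one (hDo : IsOpen D) (hDc : IsPreconnected D)
    (hG : DifferentiableOn ℂ G D) (hGnc : ¬ ∃ a : ℂ, ∀ w ∈ D, G w = a)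
    (hG1 : ∀ w ∈ D, ‖G w‖ < 1) {r : ℝ} (hr : |r| ≤ 1 / supNorm D G ^ 2) {w : ℂ} (hw : w ∈ D) :
    |r| * ‖G w‖ ^ 2 < 1 := by
  have h1 := norm_lt_supNorm hDo hDc hG hGnc hG1 hw
  have h2 : 0 < supNorm D G := (norm_nonneg _).trans_lt h1
  rw [le_div_iff₀ (by positivity)] at hr
  -- Strictness comes from the maximum principle and survives multiplication by |r| only if r ≠ 0.
  rcases (abs_nonneg r).eq_or_lt with h0 | h0
  · rw [← h0]; norm_num
  · exact (mul_lt_mul_of_pos_left (pow_lt_pow_left₀ h1 (norm_nonneg _) two_ne_zero) h0).trans_le hr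

theorem one_le_one_div_supNorm_sq (hDo : IsOpen D) (hDc : IsPreconnected D) (hw₀ : w₀ ∈ D)
    (hG : DifferentiableOn ℂ G D) (hGnc : ¬ ∃ a : ℂ, ∀ w ∈ D, G w = a)
    (hG1 : ∀ w ∈ D, ‖G w‖ < 1) : 1 ≤ 1 / supNorm D G ^ 2 := by
  have h1 : 0 < supNorm D G :=
    (norm_nonneg _).trans_lt (norm_lt_supNorm hDo hDc hG hGnc hG1 hw₀)
  have h2 : supNorm D G ≤ 1 := csSup_le (Nonempty.image _ ⟨w₀, hw₀⟩) (by
    rintro _ ⟨z, hz, rfl⟩; exact (hG1 z hz).le)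
  rw [le_div_iff₀ (by positivity), one_mul]
  exact pow_le_one₀ h1.le h2

theorem convex_image_const_mul {Ω : Set ℂ} (hΩ : Convex ℝ Ω) (μ : ℂ) :
    Convex ℝ ((fun z => μ * z) '' Ω) :=
  hΩ.is_linear_image (LinearMap.mulLeft ℝ μ).isLinear

/-- The factor `e^{iθ} / λ`. -/
noncomputable def scale (θ lam : ℝ) : ℂ := Complex.exp (Complex.I * θ) / lam

theorem scale_ne_zero (θ : ℝ) {lam : ℝ} (h : 0 < lam) : scale θ lam ≠ 0 :=
  div_ne_zero (Complex.exp_ne_zero _) (Complex.ofReal_ne_zero.2 h.ne')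

/-- If `G` factors through `h = ∫ F`, the surface is parametrized by a harmonic map
`z ↦ z + conj (k z)` of a homothetic image of `h(D)`. -/
theorem exists_surfaceMap_eq (hDo : IsOpen D) (hDs : IsSimplyConnected D) (hw₀ : w₀ ∈ D)
    (hF : DifferentiableOn ℂ F D) {g : ℂ → ℂ}
    {Ω : Set ℂ} (θ lam c : ℝ)
    (hΩ : Ω = (fun w => scale θ lam * primitive D w₀ F w) '' D)
    (hΩo : IsOpen Ω) (hΩc : Convex ℝ Ω)
    (hg : DifferentiableOn ℂ g Ω) (hGg : ∀ w ∈ D, G w = g (scale θ lam * primitive D w₀ F w)) :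
    ∃ k e : ℂ → ℂ, (∀ z ∈ Ω, HasDerivAt k (-(c * lam ^ 2 * g z ^ 2)) z) ∧
      ∀ w ∈ D, surfaceMap D w₀ F G θ lam c w =
        (scale θ lam * primitive D w₀ F w + conj (k (scale θ lam * primitive D w₀ F w)),
          (e (scale θ lam * primitive D w₀ F w)).re) := by
  set μ := scale θ lam with hμ
  obtain ⟨hh0, hh⟩ := primitive_spec hDo hDs w₀ hF
  set h := primitive D w₀ F
  have hne : Ω.Nonempty := by rw [hΩ]; exact ⟨_, w₀, hw₀, rfl⟩
  have hΩs : IsSimplyConnected Ω := by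
    have := hΩc.contractibleSpace hne
    exact (inferInstance : SimplyConnectedSpace Ω)
  obtain ⟨hk0, hk⟩ := primitive_spec hΩo hΩs 0
    (f := fun z => -(c * lam ^ 2 * g z ^ 2)) ((hg.pow 2).const_mul _).neg
  obtain ⟨he0, he⟩ := primitive_spec hΩo hΩs 0 (f := fun z => 2 * lam * g z) (hg.const_mul _)
  set k := primitive Ω 0 (fun z => -(c * lam ^ 2 * g z ^ 2))
  set e := primitive Ω 0 (fun z => 2 * lam * g z)
  have hmem : ∀ w ∈ D, μ * h w ∈ Ω := fun w hw => by rw [hΩ]; exact ⟨w, hw, rfl⟩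
  have hH : ∀ w ∈ D, HasDerivAt (fun w => μ * h w) (μ * F w) w := fun w hw =>
    (hh w hw).const_mul μ
  have hK : ∀ w ∈ D, HasDerivAt (fun w => k (μ * h w)) (-(c * lam ^ 2 * G w ^ 2) * (μ * F w)) w :=
    fun w hw => by
      rw [hGg w hw]
      exact (hk _ (hmem w hw)).comp w (hH w hw)
  have hE : ∀ w ∈ D, HasDerivAt (fun w => e (μ * h w)) (2 * lam * G w * (μ * F w)) w :=
    fun w hw => by
      rw [hGg w hw]
      exact (he _ (hmem w hw)).comp w (hH w hw)
  refine ⟨k, e, hk, fun w hw => ?_⟩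
  -- With z = μh, the real and imaginary parts of z + conj k are Re (z + k) and Re (-i(z - k)).
  have e1 := primitive_eq hDo hDs hw₀ (w₀ := w₀)
    (f := fun z => (1 - c * lam ^ 2 * G z ^ 2) * (μ * F z))
    (Φ := fun w => μ * h w + k (μ * h w)) (by simp [hh0, hk0])
    (fun w hw => ((hH w hw).add (hK w hw)).congr_deriv (by ring)) w hw
  have e2 := primitive_eq hDo hDs hw₀ (w₀ := w₀)
    (f := fun z => -Complex.I * (1 + c * lam ^ 2 * G z ^ 2) * (μ * F z))
    (Φ := fun w => -Complex.I * (μ * h w - k (μ * h w))) (by simp [hh0, hk0])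
    (fun w hw => (((hH w hw).sub (hK w hw)).const_mul (-Complex.I)).congr_deriv (by ring)) w hw
  have e3 := primitive_eq hDo hDs hw₀ (w₀ := w₀)
    (f := fun z => 2 * lam * G z * (μ * F z))
    (Φ := fun w => e (μ * h w)) (by simp [hh0, he0]) hE w hw
  unfold surfaceMap
  simp only [← scale.eq_1, ← hμ]
  rw [e1, e2, e3]
  refine Prod.ext (Complex.ext ?_ ?_) rfl
  · simp
  · simp; ring

/-- The case `c = 0`: the horizontal component is a multiple of `h`. -/
theorem surfaceMap_zero_fst (hDo : IsOpen D) (hDs : IsSimplyConnected D) (hw₀ : w₀ ∈ D)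
    (hF : DifferentiableOn ℂ F D) (θ lam : ℝ) {w : ℂ} (hw : w ∈ D) :
    (surfaceMap D w₀ F G θ lam 0 w).1 = scale θ lam * primitive D w₀ F w := by
  obtain ⟨hh0, hh⟩ := primitive_spec hDo hDs w₀ hF
  set h := primitive D w₀ F
  set μ := scale θ lam with hμ
  have hH : ∀ w ∈ D, HasDerivAt (fun w => μ * h w) (μ * F w) w := fun w hw =>
    (hh w hw).const_mul μ
  have e1 := primitive_eq hDo hDs hw₀ (w₀ := w₀)
    (f := fun z => (1 - ((0 : ℝ) : ℂ) * lam ^ 2 * G z ^ 2) * (μ * F z))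
    (Φ := fun w => μ * h w) (by simp [hh0])
    (fun w hw => (hH w hw).congr_deriv (by simp)) w hw
  have e2 := primitive_eq hDo hDs hw₀ (w₀ := w₀)
    (f := fun z => -Complex.I * (1 + ((0 : ℝ) : ℂ) * lam ^ 2 * G z ^ 2) * (μ * F z))
    (Φ := fun w => -Complex.I * (μ * h w)) (by simp [hh0])
    (fun w hw => ((hH w hw).const_mul (-Complex.I)).congr_deriv (by simp)) w hw
  unfold surfaceMap
  simp only [← scale.eq_1, ← hμ]
  rw [e1, e2]
  refine Complex.ext ?_ ?_ <;> simp

theorem isOpen_image_primitive (hDo : IsOpen D) (hDs : IsSimplyConnected D) (w₀ : ℂ)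
    (hF : DifferentiableOn ℂ F D) (hF0 : ∃ w ∈ D, F w ≠ 0) : IsOpen (primitive D w₀ F '' D) := by
  obtain ⟨-, hh⟩ := primitive_spec hDo hDs w₀ hF
  rw [isOpen_iff_mem_nhds]
  rintro _ ⟨w, hw, rfl⟩
  exact nhds_le_map_nhds_of_eventually_deriv_ne_zero hDo hh hw
    (eventually_ne_zero_of_isPreconnected hDo hDs.isPathConnected.isConnected.isPreconnected
      hF hF0 hw) (image_mem_map (hDo.mem_nhds hw))

/-- If `h(D)` is convex and `G` is constant on the fibres of `h`, all the surfaces are graphs over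
close-to-convex domains, and their points determine the value of `h`. -/
theorem isGraphOverCloseToConvex_surface (hDo : IsOpen D) (hDs : IsSimplyConnected D)
    (hw₀ : w₀ ∈ D) (hF : DifferentiableOn ℂ F D) (hF0 : ∃ w ∈ D, F w ≠ 0)
    (hG : DifferentiableOn ℂ G D) (hGnc : ¬ ∃ a : ℂ, ∀ w ∈ D, G w = a)
    (hG1 : ∀ w ∈ D, ‖G w‖ < 1) (hconv : Convex ℝ (primitive D w₀ F '' D))
    (hfib : ∀ a ∈ D, ∀ b ∈ D, primitive D w₀ F a = primitive D w₀ F b → G a = G b)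
    {θ lam c : ℝ} (hlam : 0 < lam) (hc : |c * lam ^ 2| ≤ 1 / supNorm D G ^ 2) :
    IsGraphOverCloseToConvex (surface D w₀ F G θ lam c) ∧
      ∀ a ∈ D, ∀ b ∈ D, surfaceMap D w₀ F G θ lam c a = surfaceMap D w₀ F G θ lam c b →
        primitive D w₀ F a = primitive D w₀ F b := by
  have hDc : IsPreconnected D := hDs.isPathConnected.isConnected.isPreconnected
  have hμ0 := scale_ne_zero θ hlam
  obtain ⟨-, hh⟩ := primitive_spec hDo hDs w₀ hF
  have hho := isOpen_image_primitive hDo hDs w₀ hF hF0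
  set Ω := (fun w => scale θ lam * primitive D w₀ F w) '' D with hΩ
  have hΩ' : Ω = (fun z => scale θ lam * z) '' (primitive D w₀ F '' D) := by
    rw [hΩ, image_image]
  have hΩo : IsOpen Ω := by
    rw [hΩ']
    exact (Homeomorph.mulLeft₀ _ hμ0).isOpenMap _ hho
  have hΩc : Convex ℝ Ω := by
    rw [hΩ']
    exact convex_image_const_mul hconv _
  have hΩne : Ω.Nonempty := ⟨_, w₀, hw₀, rfl⟩
  obtain ⟨w₁, hw₁, hFw₁⟩ := hF0
  obtain ⟨g, hg, hGg⟩ := exists_holomorphic_factor (F := fun w => scale θ lam * F w)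
    (h := fun w => scale θ lam * primitive D w₀ F w) hDo hDc (hF.const_mul _)
    ⟨w₁, hw₁, mul_ne_zero hμ0 hFw₁⟩ (fun w hw => (hh w hw).const_mul _) hG
    (fun a ha b hb hab => hfib a ha b hb (mul_left_cancel₀ hμ0 hab))
  obtain ⟨k, e, hk, hX⟩ := exists_surfaceMap_eq hDo hDs hw₀ hF θ lam c hΩ hΩo hΩc hg hGg
  have hk' : ∀ z ∈ Ω, ‖-((c : ℂ) * lam ^ 2 * g z ^ 2)‖ < 1 := by
    rintro _ ⟨w, hw, rfl⟩
    have h1 := abs_mul_norm_sq_lt_one hDo hDc hG hGnc hG1 hc hw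
    simp only
    rw [← hGg w hw, norm_neg, norm_mul, norm_pow]
    have h2 : ‖(c : ℂ) * lam ^ 2‖ = |c * lam ^ 2| := by
      rw [← Real.norm_eq_abs, ← Complex.norm_real]
      push_cast
      rfl
    rwa [h2]
  have hinj := injOn_add_conj hΩo hΩc hk hk'
  have hctc := isCloseToConvexDomain_image_add_conj hΩo hΩc hΩne hk hk'
  refine ⟨⟨_, hctc, fun y => (e (Function.invFunOn (fun z => z + conj (k z)) Ω y)).re, ?_⟩, ?_⟩
  · have hinv := hinj.leftInvOn_invFunOn
    ext ⟨y, t⟩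
    constructor
    · rintro ⟨w, hw, hwy⟩
      rw [hX w hw] at hwy
      have hmem : scale θ lam * primitive D w₀ F w ∈ Ω := ⟨w, hw, rfl⟩
      obtain ⟨rfl, rfl⟩ := Prod.mk.inj hwy
      exact ⟨⟨_, hmem, rfl⟩, by
        have := hinv hmem
        simp only at this ⊢
        rw [this]⟩
    · rintro ⟨⟨z, hz, hzy⟩, ht⟩
      obtain ⟨w, hw, rfl⟩ := id hz
      refine ⟨w, hw, ?_⟩
      have := hinv hz
      simp only at this ht hzy
      rw [hX w hw, ht, ← hzy, this]
  · intro a ha b hb hab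
    rw [hX a ha, hX b hb] at hab
    exact mul_left_cancel₀ hμ0 (hinj ⟨a, ha, rfl⟩ ⟨b, hb, rfl⟩ (Prod.mk.inj hab).1)

/-- If one surface with `c = 0` is a graph over a convex domain, then `h(D)` is convex, and the
points of that surface are determined by the value of `h`. -/
theorem convex_image_of_isGraphOverConvex (hDo : IsOpen D) (hDs : IsSimplyConnected D)
    (hw₀ : w₀ ∈ D) (hF : DifferentiableOn ℂ F D) {θ lam : ℝ} (hlam : 0 < lam)
    (hgr : IsGraphOverConvex (surface D w₀ F G θ lam 0)) :
    Convex ℝ (primitive D w₀ F '' D) ∧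
      ∀ a ∈ D, ∀ b ∈ D, primitive D w₀ F a = primitive D w₀ F b →
        surfaceMap D w₀ F G θ lam 0 a = surfaceMap D w₀ F G θ lam 0 b := by
  obtain ⟨Ω, ⟨-, hΩc⟩, φ, hS⟩ := hgr
  have hμ0 := scale_ne_zero θ hlam
  have hX := fun w hw => surfaceMap_zero_fst (G := G) hDo hDs hw₀ hF θ lam (w := w) hw
  have hmem : ∀ w ∈ D, surfaceMap D w₀ F G θ lam 0 w ∈ {p : ℂ × ℝ | p.1 ∈ Ω ∧ p.2 = φ p.1} :=
    fun w hw => hS ▸ mem_image_of_mem _ hw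
  constructor
  · have himg : primitive D w₀ F '' D = (fun z => (scale θ lam)⁻¹ * z) '' Ω := by
      ext z
      constructor
      · rintro ⟨w, hw, rfl⟩
        refine ⟨_, (hmem w hw).1, ?_⟩
        simp only
        rw [hX w hw, inv_mul_cancel_left₀ hμ0]
      · rintro ⟨z, hz, rfl⟩
        have : (z, φ z) ∈ surface D w₀ F G θ lam 0 := by rw [hS]; exact ⟨hz, rfl⟩
        obtain ⟨w, hw, hwz⟩ := this
        refine ⟨w, hw, ?_⟩
        have h1 := hX w hw
        rw [hwz] at h1
        simp only at h1 ⊢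
        rw [h1, inv_mul_cancel_left₀ hμ0]
    rw [himg]
    exact convex_image_const_mul hΩc _
  · intro a ha b hb hab
    have h1 : (surfaceMap D w₀ F G θ lam 0 a).1 = (surfaceMap D w₀ F G θ lam 0 b).1 := by
      rw [hX a ha, hX b hb, hab]
    exact Prod.ext h1 (by rw [(hmem a ha).2, (hmem b hb).2, h1])

/-- On a graph the height depends only on the horizontal part, here a multiple of h. The height is
the real part of a primitive of 2λG·μF, so `eq_of_re_eq_of_eq` applies with 2λG and μF. -/
theorem eq_of_primitive_eq_of_isGraphOverConvex (hDo : IsOpen D) (hDs : IsSimplyConnected D)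
    (hw₀ : w₀ ∈ D) (hF : DifferentiableOn ℂ F D) (hF0 : ∃ w ∈ D, F w ≠ 0)
    (hG : DifferentiableOn ℂ G D) {θ lam : ℝ} (hlam : 0 < lam)
    (hgr : IsGraphOverConvex (surface D w₀ F G θ lam 0)) :
    ∀ a ∈ D, ∀ b ∈ D, primitive D w₀ F a = primitive D w₀ F b → G a = G b := by
  have hDc : IsPreconnected D := hDs.isPathConnected.isConnected.isPreconnected
  have hμ0 := scale_ne_zero θ hlam
  obtain ⟨-, hh⟩ := primitive_spec hDo hDs w₀ hF
  have hlam0 : (2 * lam : ℂ) ≠ 0 := mul_ne_zero two_ne_zero (Complex.ofReal_ne_zero.2 hlam.ne')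
  obtain ⟨-, hU⟩ := primitive_spec hDo hDs w₀ (f := fun z => 2 * lam * G z * (scale θ lam * F z))
    ((hG.const_mul _).mul (hF.const_mul _))
  obtain ⟨w₁, hw₁, hFw₁⟩ := hF0
  intro a ha b hb hab
  refine mul_left_cancel₀ hlam0 (eq_of_re_eq_of_eq (G := fun w => 2 * lam * G w)
    (F := fun w => scale θ lam * F w) (h := fun w => scale θ lam * primitive D w₀ F w)
    hDo hDc (hF.const_mul _) ⟨w₁, hw₁, mul_ne_zero hμ0 hFw₁⟩ (fun w hw => (hh w hw).const_mul _)
    (hG.const_mul _) hU ?_ a ha b hb (by rw [hab]))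
  intro x hx y hy hxy
  have := (convex_image_of_isGraphOverConvex hDo hDs hw₀ hF hlam hgr).2 x hx y hy
    (mul_left_cancel₀ hμ0 hxy)
  exact (Prod.ext_iff.1 this).2

end Surface

end Krust

theorem theorem1p3 (D : Set ℂ) (hDo : IsOpen D) (hDs : IsSimplyConnected D) (hDne : D ≠ Set.univ)
    (w₀ : ℂ) (hw₀ : w₀ ∈ D) (F G : ℂ → ℂ)
    (hF : DifferentiableOn ℂ F D) (hF0 : ∃ w ∈ D, F w ≠ 0)
    (hG : DifferentiableOn ℂ G D) (hGnc : ¬ ∃ a : ℂ, ∀ w ∈ D, G w = a)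
    (hG1 : ∀ w ∈ D, ‖G w‖ < 1) :
    -- surfaces as subsets of three-space
    ((∃ θ₀ lam₀ : ℝ, 0 < lam₀ ∧ Krust.IsGraphOverConvex (Krust.surface D w₀ F G θ₀ lam₀ 0)) →
      (∀ θ lam c : ℝ, 0 < lam → |c * lam ^ 2| ≤ 1 / Krust.supNorm D G ^ 2 →
        Krust.IsGraphOverCloseToConvex (Krust.surface D w₀ F G θ lam c)) ∧
      ∀ θ : ℝ, Krust.IsGraph (Krust.surface D w₀ F G θ 1 1) ∧
        Krust.IsGraph (Krust.surface D w₀ F G θ 1 (-1))) ∧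
    -- the hypothesis, for an injectively parametrized surface, in terms of `h = ∫ F dw`
    ((∃ θ₀ lam₀ : ℝ, 0 < lam₀ ∧ Krust.IsGraphOverConvex (Krust.surface D w₀ F G θ₀ lam₀ 0) ∧
        Set.InjOn (Krust.surfaceMap D w₀ F G θ₀ lam₀ 0) D) ↔
      Set.InjOn (Krust.primitive D w₀ F) D ∧ Convex ℝ (Krust.primitive D w₀ F '' D)) ∧
    -- the conclusion, for an injectively parametrized surface
    (Set.InjOn (Krust.primitive D w₀ F) D → Convex ℝ (Krust.primitive D w₀ F '' D) →
      ∀ θ lam c : ℝ, 0 < lam → |c * lam ^ 2| ≤ 1 / Krust.supNorm D G ^ 2 →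
        Set.InjOn (Krust.surfaceMap D w₀ F G θ lam c) D) := by
  have hDc : IsPreconnected D := hDs.isPathConnected.isConnected.isPreconnected
  refine ⟨?_, ⟨?_, ?_⟩, ?_⟩
  · rintro ⟨θ₀, lam₀, hlam₀, hgr⟩
    have hconv := (Krust.convex_image_of_isGraphOverConvex hDo hDs hw₀ hF hlam₀ hgr).1
    have hfib := Krust.eq_of_primitive_eq_of_isGraphOverConvex hDo hDs hw₀ hF hF0 hG hlam₀ hgr
    have hall : ∀ θ lam c : ℝ, 0 < lam → |c * lam ^ 2| ≤ 1 / Krust.supNorm D G ^ 2 →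
        Krust.IsGraphOverCloseToConvex (Krust.surface D w₀ F G θ lam c) :=
      fun θ lam c hlam hc => (Krust.isGraphOverCloseToConvex_surface hDo hDs hw₀ hF hF0 hG hGnc
        hG1 hconv hfib hlam hc).1
    have hone := Krust.one_le_one_div_supNorm_sq hDo hDc hw₀ hG hGnc hG1
    refine ⟨hall, fun θ => ⟨?_, ?_⟩⟩
    · obtain ⟨Ω, hΩ, h⟩ := hall θ 1 1 one_pos (by simpa using hone)
      exact ⟨Ω, hΩ.1, h⟩
    · obtain ⟨Ω, hΩ, h⟩ := hall θ 1 (-1) one_pos (by simpa using hone)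
      exact ⟨Ω, hΩ.1, h⟩
  · rintro ⟨θ₀, lam₀, hlam₀, hgr, hinj⟩
    obtain ⟨hconv, h⟩ := Krust.convex_image_of_isGraphOverConvex hDo hDs hw₀ hF hlam₀ hgr
    exact ⟨fun a ha b hb hab => hinj ha hb (h a ha b hb hab), hconv⟩
  · rintro ⟨hinj, hconv⟩
    have hX := fun w hw => Krust.surfaceMap_zero_fst (G := G) hDo hDs hw₀ hF 0 1 (w := w) hw
    -- For θ = 0 and λ = 1 the horizontal part is h itself.
    have hscale : Krust.scale 0 1 = 1 := by simp [Krust.scale]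
    simp only [hscale, one_mul] at hX
    refine ⟨0, 1, one_pos, ⟨Krust.primitive D w₀ F '' D,
      ⟨⟨Krust.isOpen_image_primitive hDo hDs w₀ hF hF0, hconv.isConnected ⟨_, w₀, hw₀, rfl⟩⟩, hconv⟩,
      fun z => (Krust.surfaceMap D w₀ F G 0 1 0
        (Function.invFunOn (Krust.primitive D w₀ F) D z)).2, ?_⟩, ?_⟩
    · have hinv := hinj.leftInvOn_invFunOn
      ext p
      constructor
      · rintro ⟨w, hw, rfl⟩
        refine ⟨⟨w, hw, (hX w hw).symm⟩, ?_⟩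
        simp only
        rw [hX w hw, hinv hw]
      · rintro ⟨⟨w, hw, hwp⟩, hp⟩
        simp only at hp
        rw [← hwp, hinv hw] at hp
        exact ⟨w, hw, Prod.ext ((hX w hw).trans hwp) hp.symm⟩
    · intro a ha b hb hab
      exact hinj ha hb (by rw [← hX a ha, ← hX b hb, hab])
  · intro hinj hconv θ lam c hlam hc a ha b hb hab
    exact hinj ha hb ((Krust.isGraphOverCloseToConvex_surface hDo hDs hw₀ hF hF0 hG hGnc hG1 hconv
      (fun a ha b hb hab => congrArg G (hinj ha hb hab)) hlam hc).2 a ha b hb hab)
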